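/- **Lemma 3.1.** Let $F$ be an algebraically closed field of characteristic zero, let $(q_{ij})_{1\le i,j\le n}$ be a matrix with entries in $F^*=F\setminus\{0\}$, and let $V$ be the braided vector space of diagonal type with basis $x_1,\dots,x_n$ and braiding $C(x_i\otimes x_j)=q_{ij}\,x_j\otimes x_i$. Let $\mathfrak B(V)$ be its Nichols algebra (the quotient of the tensor algebra $T(V)$ by the kernel of the quantum symmetrizers), graded by $\mathbb N_0^n$ with $\deg x_i=e_i$; "homogeneous" refers to this grading. Let $\chi$ be the bicharacter on $\mathbb Z^n$ with $\chi(e_i,e_j)=q_{ij}$, and put $p_{ij}=q_{ij}$ and $p_{yx}=\chi(\deg y,\deg x)$ for homogeneous $x,y$. Let $\mathfrak L(V)$ be the Nichols braided Lie algebra of $V$, i.e. the smallest subspace of $\mathfrak B(V)$ that contains $V$ and is closed under the brackets $[x,y]=yx-p_{yx}\,xy$ of its homogeneous elements $x,y$. Let $\Gamma(V)$ be the graph with vertices $x_1,\dots,x_n$ in which $x_i$ and $x_j$ ($i\ne j$) are adjacent if and only if $p_{ij}p_{ji}\ne1$. A set of vertices is called connected if it is non-empty and the subgraph of $\Gamma(V)$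 that it generates is connected; a monomial $x_{i_1}\cdots x_{i_m}$ is called connected if $\{x_{i_1},\dots,x_{i_m}\}$ is connected. The monomials of a homogeneous element $u\neq 0$ are those that occur with a non-zero coefficient in some expression of $u$ as a linear combination of non-zero monomials of the same multidegree, and $\mu(u)$ is the set of all letters $x_i$ that occur in the monomials of $u$. Let $u$ be a non-zero homogeneous element of $\mathfrak B(V)$, and assume that $p_{ii}\ne1$ whenever $\mu(u)=\{x_i\}$. Then $u\in\mathfrak L(V)$ if and only if $\mu(u)$ is connected. Moreover, $\mu(u)$ is connected if and only if every monomial of $u$ is connected. -/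

import Mathlib

namespace NicholsDiag

/-! The braiding matrix is `q : Fin n → Fin n → Fˣ`.  The tensor algebra `T(V)` of the vector space
`V` with basis `x_0, …, x_{n-1}` is the free algebra on the index set `Fin n`; words in the letters
`x_i` are lists of indices.  The braiding of `V` is `C (x_i ⊗ x_j) = q i j • x_j ⊗ x_i`. -/

/-- The word `x_{i_1} ⋯ x_{i_m}` as an element of `T(V)`. -/
noncomputable def tensorWord {n : ℕ} (F : Type*) [Field F] (w : List (Fin n)) :
    FreeAlgebra F (Fin n) :=
  (w.map (FreeAlgebra.ι F)).prod

/-- The scalar by which the braid lift of `σ` acts on the word `w`: each pair of positions `k < l`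
whose letters are interchanged by `σ` contributes the factor `q_{w_k w_l}`. -/
noncomputable def braidCoeff {n : ℕ} {F : Type*} [Field F] (q : Fin n → Fin n → Fˣ)
    (w : List (Fin n)) (σ : Equiv.Perm (Fin w.length)) : Fˣ :=
  ∏ k : Fin w.length, ∏ l : Fin w.length,
    if k < l ∧ σ l < σ k then q (w.get k) (w.get l) else 1

/-- The braided action of the permutation `σ` (its positive braid lift, acting through `C`) on the
word `w`: the letter at position `k` moves to position `σ k`. -/
noncomputable def braidAct {n : ℕ} {F : Type*} [Field F] (q : Fin n → Fin n → Fˣ)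
    (w : List (Fin n)) (σ : Equiv.Perm (Fin w.length)) : FreeAlgebra F (Fin n) :=
  (braidCoeff q w σ : F) • tensorWord F (List.ofFn fun k => w.get (σ.symm k))

/-- The quantum symmetrizer on `T(V)`: on `V^{⊗ m}` it is the sum of the braid lifts of all
permutations of `m` letters. -/
noncomputable def quantumSymmetrizer {n : ℕ} {F : Type*} [Field F] (q : Fin n → Fin n → Fˣ) :
    FreeAlgebra F (Fin n) →ₗ[F] FreeAlgebra F (Fin n) :=
  (FreeAlgebra.basisFreeMonoid F (Fin n)).constr F fun w =>
    ∑ σ : Equiv.Perm (Fin w.toList.length), braidAct q w.toList σ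

/-- The Nichols algebra `𝔅(V)`: the quotient of `T(V)` by the kernel of the quantum symmetrizer. -/
abbrev NicholsAlgebra {n : ℕ} {F : Type*} [Field F] (q : Fin n → Fin n → Fˣ) : Type _ :=
  RingQuot fun a b : FreeAlgebra F (Fin n) => quantumSymmetrizer q a = quantumSymmetrizer q b

/-- The monomial `x_{i_1} ⋯ x_{i_m}` of `𝔅(V)`. -/
noncomputable def monomial {n : ℕ} {F : Type*} [Field F] (q : Fin n → Fin n → Fˣ)
    (w : List (Fin n)) : NicholsAlgebra q :=
  RingQuot.mkAlgHom F
    (fun a b : FreeAlgebra F (Fin n) => quantumSymmetrizer q a = quantumSymmetrizer q b)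
    (tensorWord F w)

/-- The multidegree of a word: the coefficient of `e_i` is the number of letters `x_i`. -/
def wordDeg {n : ℕ} (w : List (Fin n)) : Fin n → ℕ := fun i => w.count i

/-- The component of multidegree `d` of `𝔅(V)`. -/
noncomputable def homogeneousPart {n : ℕ} {F : Type*} [Field F] (q : Fin n → Fin n → Fˣ)
    (d : Fin n → ℕ) : Submodule F (NicholsAlgebra q) :=
  Submodule.span F (monomial q '' {w | wordDeg w = d})

/-- The bicharacter `χ` with `χ (e_i, e_j) = q_{ij}`. -/
noncomputable def chi {n : ℕ} {F : Type*} [Field F] (q : Fin n → Fin n → Fˣ)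
    (d e : Fin n → ℕ) : Fˣ :=
  ∏ i, ∏ j, q i j ^ (d i * e j)

/-- The braided bracket `[x, y] = y x - p_{yx} x y` for `x` of degree `d` and `y` of degree `e`. -/
noncomputable def braidedBracket {n : ℕ} {F : Type*} [Field F] (q : Fin n → Fin n → Fˣ)
    (d e : Fin n → ℕ) (x y : NicholsAlgebra q) : NicholsAlgebra q :=
  y * x - (chi q e d : F) • (x * y)

/-- `W` is closed under the braided brackets of its homogeneous elements. -/
def BracketClosed {n : ℕ} {F : Type*} [Field F] (q : Fin n → Fin n → Fˣ)
    (W : Submodule F (NicholsAlgebra q)) : Prop :=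
  ∀ (d e : Fin n → ℕ) (x y : NicholsAlgebra q), x ∈ W → y ∈ W →
    x ∈ homogeneousPart q d → y ∈ homogeneousPart q e → braidedBracket q d e x y ∈ W

/-- The Nichols braided Lie algebra `𝔏(V)`: the smallest subspace of `𝔅(V)` that contains `V` and
is closed under the braided brackets of homogeneous elements. -/
noncomputable def nicholsBraidedLie {n : ℕ} {F : Type*} [Field F] (q : Fin n → Fin n → Fˣ) :
    Submodule F (NicholsAlgebra q) :=
  sInf {W | (∀ i, monomial q [i] ∈ W) ∧ BracketClosed q W}

/-- The pure generalized Dynkin graph `Γ(V)`. -/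
def dynkinGraph {n : ℕ} {F : Type*} [Field F] (q : Fin n → Fin n → Fˣ) : SimpleGraph (Fin n) where
  Adj i j := i ≠ j ∧ q i j * q j i ≠ 1
  symm := ⟨fun i j h => ⟨h.1.symm, by rw [mul_comm]; exact h.2⟩⟩
  loopless := ⟨fun _ h => h.1 rfl⟩

/-- A set of letters is connected if the subgraph of `Γ(V)` it generates is connected; in
particular, it is then non-empty. -/
def ConnectedLetters {n : ℕ} {F : Type*} [Field F] (q : Fin n → Fin n → Fˣ)
    (s : Set (Fin n)) : Prop :=
  ((dynkinGraph q).induce s).Connected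

/-- The word `w` is a monomial of `u`: it occurs with a non-zero coefficient in an expression of `u`
as a linear combination of non-zero monomials of one and the same multidegree. -/
def IsMonomialOf {n : ℕ} {F : Type*} [Field F] (q : Fin n → Fin n → Fˣ)
    (u : NicholsAlgebra q) (w : List (Fin n)) : Prop :=
  ∃ (d : Fin n → ℕ) (f : List (Fin n) →₀ F),
    (∀ v ∈ f.support, wordDeg v = d ∧ monomial q v ≠ 0) ∧
    (f.sum fun v a => a • monomial q v) = u ∧ f w ≠ 0

/-- `μ(u)`: the set of (indices of) letters that occur in the monomials of `u`. -/
def mu {n : ℕ} {F : Type*} [Field F] (q : Fin n → Fin n → Fˣ)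
    (u : NicholsAlgebra q) : Set (Fin n) :=
  {i | ∃ w, IsMonomialOf q u w ∧ i ∈ w}

end NicholsDiag

/-! Everything depends only on the multidegree of `u`: membership in `𝔏(V)` and connectedness are both
decided by the support of that degree.

The quantum symmetrizer preserves the multidegree, so the coaction of `ℕ₀ⁿ` on `T(V)` descends to
`𝔅(V)` (`coaction`). Hence a nonzero homogeneous element `u` has only one multidegree `d`, every
monomial of `u` has this multidegree, and `μ(u)` is the support of `d`. This gives the equivalence
of the connectedness of `μ(u)` with that of each monomial.

If `u ∈ 𝔏(V)`, the support of `d` is connected: the elements all of whose components have connected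
support are closed under brackets, because letters that are distinct and not adjacent commute up to
the braiding, which makes the bracket of two mutually disconnected elements zero
(`bracketClosed_connectedPart`).

Conversely, every word `w` with connected letters lies in `𝔏(V)`, unless it is a power `x_i ^ k`
with `k ≥ 2` and `q i i = 1`. For a power `x_i ^ k` with `q i i ≠ 1` the bracket
`[x_i ^ (k - 1), x_i]` gives this by induction unless `q i i ^ (k - 1) = 1`, and then `x_i ^ k = 0`
as the quantum factorial vanishes (`monomial_replicate_mem`). For words with at least two different
letters one uses induction on the length. Modulo `𝔏(V)` a connected block `u` can be rotated from
the front of `u ++ v` to its end, with the factor `χ(deg u, deg v)`: this is the bracket if `v` lies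
in `𝔏(V)`, and otherwise `v` is, up to a scalar, a product of two commuting blocks which can be
rotated one after the other (`rotates_of_connected`). If `x_i` and `x_j` are adjacent, rotating them
one by one and rotating the block `x_i x_j` give factors that differ by `q i j * q j i ≠ 1`, so
`x_i x_j v` lies in `𝔏(V)` (`mem_of_rotates_of_adj`). Every connected word can be brought into this
form by commutations and rotations (`ConnectedWordsMem.succ`).

The relations `quantumSymmetrizer q a = quantumSymmetrizer q b` of `𝔅(V)` are all that is used; it is
not needed that the kernel of the quantum symmetrizer is an ideal. -/

/-! ### Words, the bicharacter and commutation of letters -/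

namespace NicholsDiag

variable {F : Type*} [Field F] {n : ℕ} (q : Fin n → Fin n → Fˣ)

theorem tensorWord_append (u v : List (Fin n)) :
    tensorWord F (u ++ v) = tensorWord F u * tensorWord F v := by
  simp [tensorWord]

theorem monomial_append (u v : List (Fin n)) :
    monomial q (u ++ v) = monomial q u * monomial q v := by
  simp [monomial, tensorWord_append]

theorem monomial_cons (i : Fin n) (v : List (Fin n)) :
    monomial q (i :: v) = monomial q [i] * monomial q v :=
  monomial_append q [i] v

theorem wordDeg_append (u v : List (Fin n)) : wordDeg (u ++ v) = wordDeg u + wordDeg v := by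
  funext i; simp [wordDeg]

theorem wordDeg_cons (i : Fin n) (v : List (Fin n)) :
    wordDeg (i :: v) = wordDeg [i] + wordDeg v :=
  wordDeg_append [i] v

theorem wordDeg_eq_of_perm {u v : List (Fin n)} (h : u.Perm v) : wordDeg u = wordDeg v := by
  funext i; exact h.count_eq i

theorem wordDeg_ne_zero_iff {w : List (Fin n)} {i : Fin n} : wordDeg w i ≠ 0 ↔ i ∈ w := by
  simp [wordDeg, List.count_eq_zero]

theorem monomial_mem_homogeneousPart (w : List (Fin n)) :
    monomial q w ∈ homogeneousPart q (wordDeg w) :=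
  Submodule.subset_span ⟨w, rfl, rfl⟩

theorem chi_add_left (d d' e : Fin n → ℕ) : chi q (d + d') e = chi q d e * chi q d' e := by
  simp [chi, add_mul, pow_add, Finset.prod_mul_distrib]

theorem chi_add_right (d e e' : Fin n → ℕ) : chi q d (e + e') = chi q d e * chi q d e' := by
  simp [chi, mul_add, pow_add, Finset.prod_mul_distrib]

@[simp] theorem chi_nil_left (e : Fin n → ℕ) : chi q (wordDeg []) e = 1 := by
  simp [chi, wordDeg]

@[simp] theorem chi_nil_right (d : Fin n → ℕ) : chi q d (wordDeg []) = 1 := by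
  simp [chi, wordDeg]

@[simp] theorem chi_singleton (i j : Fin n) : chi q (wordDeg [i]) (wordDeg [j]) = q i j := by
  unfold chi
  rw [Finset.prod_eq_single i, Finset.prod_eq_single j] <;>
    simp +contextual [wordDeg, List.count_cons, Ne.symm]

theorem chi_mul_chi_eq_one {u v : List (Fin n)}
    (h : ∀ i ∈ u, ∀ j ∈ v, q i j * q j i = 1) :
    chi q (wordDeg u) (wordDeg v) * chi q (wordDeg v) (wordDeg u) = 1 := by
  have : chi q (wordDeg v) (wordDeg u) = ∏ i, ∏ j, q j i ^ (wordDeg u i * wordDeg v j) := by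
    unfold chi
    rw [Finset.prod_comm]
    simp only [mul_comm]
  rw [this, chi, ← Finset.prod_mul_distrib]
  refine Finset.prod_eq_one fun i _ => ?_
  rw [← Finset.prod_mul_distrib]
  refine Finset.prod_eq_one fun j _ => ?_
  rw [← mul_pow]
  by_cases hi : i ∈ u
  · by_cases hj : j ∈ v
    · simp [h i hi j hj]
    · rw [not_not.mp (mt wordDeg_ne_zero_iff.mp hj)]; simp
  · rw [not_not.mp (mt wordDeg_ne_zero_iff.mp hi)]; simp

theorem basisFreeMonoid_apply (w : FreeMonoid (Fin n)) :
    FreeAlgebra.basisFreeMonoid F (Fin n) w = tensorWord F w.toList := by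
  simp [FreeAlgebra.basisFreeMonoid, tensorWord, FreeAlgebra.equivMonoidAlgebraFreeMonoid,
    FreeMonoid.lift_apply]

theorem quantumSymmetrizer_tensorWord (w : List (Fin n)) :
    quantumSymmetrizer q (tensorWord F w) =
      ∑ σ : Equiv.Perm (Fin w.length), braidAct q w σ := by
  have := basisFreeMonoid_apply (F := F) (FreeMonoid.ofList w)
  rw [FreeMonoid.toList_ofList] at this
  rw [← this, quantumSymmetrizer, Module.Basis.constr_basis]
  rfl

theorem linearMap_ext_tensorWord {M : Type*} [AddCommMonoid M] [Module F M]
    {f g : FreeAlgebra F (Fin n) →ₗ[F] M}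
    (h : ∀ w, f (tensorWord F w) = g (tensorWord F w)) : f = g := by
  refine (FreeAlgebra.basisFreeMonoid F (Fin n)).ext fun w => ?_
  rw [basisFreeMonoid_apply]
  exact h _

/-- The defining relations of `𝔅(V)`. -/
theorem mkAlgHom_eq_of_quantumSymmetrizer_eq {a b : FreeAlgebra F (Fin n)}
    (h : quantumSymmetrizer q a = quantumSymmetrizer q b) :
    RingQuot.mkAlgHom F
      (fun a b : FreeAlgebra F (Fin n) => quantumSymmetrizer q a = quantumSymmetrizer q b) a =
    RingQuot.mkAlgHom F
      (fun a b : FreeAlgebra F (Fin n) => quantumSymmetrizer q a = quantumSymmetrizer q b) b :=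
  RingQuot.mkAlgHom_rel F h

theorem quantumSymmetrizer_pair (i j : Fin n) :
    quantumSymmetrizer q (tensorWord F [i, j]) =
      tensorWord F [i, j] + (q i j : F) • tensorWord F [j, i] := by
  rw [quantumSymmetrizer_tensorWord]
  have hu : (Finset.univ : Finset (Equiv.Perm (Fin 2))) = {1, Equiv.swap 0 1} := by decide
  change ∑ σ : Equiv.Perm (Fin 2), braidAct q [i, j] σ = _
  rw [hu, Finset.sum_pair (by decide)]
  congr 1
  · have : braidCoeff q [i, j] (1 : Equiv.Perm (Fin 2)) = 1 := by
      unfold braidCoeff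
      refine Finset.prod_eq_one fun k _ => Finset.prod_eq_one fun l _ => if_neg ?_
      rintro ⟨h1, h2⟩
      exact absurd h1 (not_lt.mpr h2.le)
    rw [braidAct, this, Units.val_one, one_smul]
    congr 1
  · have : braidCoeff q [i, j] (Equiv.swap 0 1 : Equiv.Perm (Fin 2)) = q i j := by
      unfold braidCoeff
      change ∏ k : Fin 2, ∏ l : Fin 2, _ = _
      simp [Fin.prod_univ_two]
    rw [braidAct, this]
    congr 2

/-- Letters that are not adjacent in `Γ(V)` commute up to the braiding. -/
theorem monomial_pair_comm {i j : Fin n} (h : q i j * q j i = 1) :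
    monomial q [i, j] = (q i j : F) • monomial q [j, i] := by
  unfold monomial
  rw [← map_smul]
  apply mkAlgHom_eq_of_quantumSymmetrizer_eq
  rw [map_smul, quantumSymmetrizer_pair, quantumSymmetrizer_pair, smul_add, smul_smul,
    ← Units.val_mul, h, Units.val_one, one_smul, add_comm]

theorem monomial_append_comm {u v : List (Fin n)} (h : ∀ i ∈ u, ∀ j ∈ v, q i j * q j i = 1) :
    monomial q (u ++ v) = (chi q (wordDeg u) (wordDeg v) : F) • monomial q (v ++ u) := by
  induction u with
  | nil => simp
  | cons i u ih =>
    have key : ∀ v : List (Fin n), (∀ j ∈ v, q i j * q j i = 1) →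
        monomial q [i] * monomial q v =
          (chi q (wordDeg [i]) (wordDeg v) : F) • (monomial q v * monomial q [i]) := by
      intro v
      induction v with
      | nil => intro _; simp [monomial, tensorWord]
      | cons j v ihv =>
        intro hv
        have h1 := monomial_pair_comm q (hv j (by simp))
        rw [monomial_cons q i [j], monomial_cons q j [i]] at h1
        rw [monomial_cons q j v, ← mul_assoc, h1, smul_mul_assoc, mul_assoc,
          ihv fun k hk => hv k (by simp [hk]), mul_smul_comm, smul_smul, wordDeg_cons j v,
          chi_add_right, chi_singleton, Units.val_mul, mul_assoc]
    have hu := ih fun k hk => h k (by simp [hk])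
    rw [monomial_append, monomial_append] at hu
    rw [monomial_append, monomial_append, monomial_cons q i u, mul_assoc, hu, mul_smul_comm,
      ← mul_assoc, key v (h i (by simp)), smul_mul_assoc, smul_smul, wordDeg_cons i u,
      chi_add_left, Units.val_mul, mul_comm (chi q (wordDeg u) _ : F), mul_assoc]

/-- A letter can be moved, up to a nonzero scalar, past letters that are equal to it or not
adjacent to it. -/
theorem exists_monomial_cons_eq_smul {i : Fin n} {v : List (Fin n)}
    (h : ∀ j ∈ v, i ≠ j → q i j * q j i = 1) :
    ∃ c : Fˣ, monomial q (i :: v) = (c : F) • monomial q (v ++ [i]) := by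
  induction v with
  | nil => exact ⟨1, by simp⟩
  | cons j v ih =>
    obtain ⟨c, hc⟩ := ih fun k hk => h k (by simp [hk])
    rw [monomial_cons q i v] at hc
    have h1 : ∃ c' : Fˣ, monomial q [i] * monomial q [j] =
        (c' : F) • (monomial q [j] * monomial q [i]) := by
      rw [← monomial_append, ← monomial_append]
      by_cases hij : i = j
      · subst hij; exact ⟨1, by simp⟩
      · exact ⟨q i j, monomial_pair_comm q (h j (by simp) hij)⟩
    obtain ⟨c', hc'⟩ := h1
    refine ⟨c' * c, ?_⟩
    rw [monomial_cons q i, monomial_cons q j v, ← mul_assoc, hc', smul_mul_assoc, mul_assoc, hc,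
      mul_smul_comm, smul_smul, Units.val_mul, List.cons_append,
      monomial_cons q j (v ++ [i])]

/-- Letters in `s` can be sorted to the front, up to a nonzero scalar, if no letter in `s` is
adjacent to a letter outside `s`. -/
theorem exists_monomial_eq_smul_filter (s : Set (Fin n)) [DecidablePred (· ∈ s)]
    {v : List (Fin n)} (h : ∀ i ∈ v, ∀ j ∈ v, i ∈ s → j ∉ s → q i j * q j i = 1) :
    ∃ c : Fˣ, monomial q v =
      (c : F) • monomial q (v.filter (· ∈ s) ++ v.filter (· ∉ s)) := by
  induction v with
  | nil => exact ⟨1, by simp⟩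
  | cons a v ih =>
    obtain ⟨c, hc⟩ := ih fun i hi j hj => h i (by simp [hi]) j (by simp [hj])
    by_cases ha : a ∈ s
    · refine ⟨c, ?_⟩
      rw [monomial_cons, hc, List.filter_cons_of_pos (by simpa using ha),
        List.filter_cons_of_neg (by simpa using ha), List.cons_append, monomial_cons q a (_ ++ _),
        mul_smul_comm]
    · obtain ⟨c', hc'⟩ := exists_monomial_cons_eq_smul q (i := a) (v := v.filter (· ∈ s))
        (fun j hj _ => by
          simp only [List.mem_filter, decide_eq_true_eq] at hj
          rw [mul_comm]
          exact h j (by simp [hj.1]) a (by simp) hj.2 ha)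
      refine ⟨c * c', ?_⟩
      rw [monomial_cons, monomial_append] at hc'
      rw [monomial_cons, hc, monomial_append, mul_smul_comm, ← mul_assoc, hc']
      rw [List.filter_cons_of_neg (by simpa using ha), List.filter_cons_of_pos (by simpa using ha),
        monomial_append, monomial_cons q a (List.filter _ _), smul_mul_assoc, mul_assoc,
        smul_smul, Units.val_mul]

end NicholsDiag

/-! ### Connected sets of letters and cuts -/

namespace NicholsDiag

variable {F : Type*} [Field F] {n : ℕ} (q : Fin n → Fin n → Fˣ)

/-- A set of letters is cut-connected if it is non-empty and every partition of it into two
non-empty parts is crossed by an edge of `Γ(V)`. -/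
def CutConnected (s : Set (Fin n)) : Prop :=
  s.Nonempty ∧ ∀ A : Set (Fin n), (s ∩ A).Nonempty → (s \ A).Nonempty →
    ∃ i ∈ s ∩ A, ∃ j ∈ s \ A, q i j * q j i ≠ 1

theorem connectedLetters_iff_cutConnected (s : Set (Fin n)) :
    ConnectedLetters q s ↔ CutConnected q s := by
  constructor
  · intro h
    refine ⟨Set.nonempty_coe_sort.mp h.nonempty, ?_⟩
    rintro A ⟨x, hxs, hxA⟩ ⟨y, hys, hyA⟩
    obtain ⟨p⟩ := h.preconnected ⟨x, hxs⟩ ⟨y, hys⟩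
    obtain ⟨d, -, h1, h2⟩ := p.exists_boundary_dart (Subtype.val ⁻¹' A) hxA hyA
    exact ⟨d.fst, ⟨d.fst.2, h1⟩, d.snd, ⟨d.snd.2, h2⟩, d.adj.2⟩
  · rintro ⟨⟨x, hx⟩, h⟩
    rw [ConnectedLetters, SimpleGraph.connected_iff_exists_forall_reachable]
    refine ⟨⟨x, hx⟩, fun ⟨y, hy⟩ => ?_⟩
    by_contra hxy
    obtain ⟨i, ⟨hi, hi', hir⟩, j, ⟨hj, hjr⟩, hij⟩ := h
      {z | ∃ hz : z ∈ s, ((dynkinGraph q).induce s).Reachable ⟨x, hx⟩ ⟨z, hz⟩}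
      ⟨x, hx, hx, SimpleGraph.Reachable.refl _⟩ ⟨y, hy, fun ⟨_, h'⟩ => hxy h'⟩
    have hne : i ≠ j := by
      rintro rfl
      exact hjr ⟨hi', hir⟩
    have hadj : ((dynkinGraph q).induce s).Adj ⟨i, hi⟩ ⟨j, hj⟩ := ⟨hne, hij⟩
    exact hjr ⟨hj, hir.trans hadj.reachable⟩

variable {q}

theorem cutConnected_singleton (i : Fin n) : CutConnected q {i} := by
  refine ⟨⟨i, rfl⟩, ?_⟩
  rintro A ⟨_, rfl, h⟩ ⟨_, rfl, h'⟩
  exact absurd h h'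

/-- A cut-connected set lies on one side of a cut that no edge crosses. -/
theorem CutConnected.subset_or_disjoint {s A : Set (Fin n)} (hs : CutConnected q s)
    (h : ∀ i ∈ s ∩ A, ∀ j ∈ s \ A, q i j * q j i = 1) : s ⊆ A ∨ Disjoint s A := by
  by_contra! hc
  obtain ⟨h1, h2⟩ := hc
  obtain ⟨y, hy, hyA⟩ := Set.not_subset.mp h1
  obtain ⟨x, hx, hxA⟩ := Set.not_disjoint_iff.mp h2
  obtain ⟨i, hi, j, hj, hij⟩ := hs.2 A ⟨x, hx, hxA⟩ ⟨y, hy, hyA⟩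
  exact hij (h i hi j hj)

theorem CutConnected.union {s t : Set (Fin n)} (hs : CutConnected q s) (ht : CutConnected q t)
    {i j : Fin n} (hi : i ∈ s) (hj : j ∈ t) (hij : i = j ∨ q i j * q j i ≠ 1) :
    CutConnected q (s ∪ t) := by
  refine ⟨hs.1.inl, fun A hA hA' => ?_⟩
  by_contra! hc
  have h1 := hs.subset_or_disjoint fun x hx y hy => hc x ⟨.inl hx.1, hx.2⟩ y ⟨.inl hy.1, hy.2⟩
  have h2 := ht.subset_or_disjoint fun x hx y hy => hc x ⟨.inr hx.1, hx.2⟩ y ⟨.inr hy.1, hy.2⟩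
  obtain ⟨x, hx, hxA⟩ := hA
  obtain ⟨y, hy, hyA⟩ := hA'
  rcases h1 with h1 | h1 <;> rcases h2 with h2 | h2
  · exact hyA (Set.union_subset h1 h2 hy)
  · have hjA := Set.disjoint_left.mp h2 hj
    rcases hij with rfl | hij
    · exact hjA (h1 hi)
    · exact hij (hc i ⟨.inl hi, h1 hi⟩ j ⟨.inr hj, hjA⟩)
  · have hiA := Set.disjoint_left.mp h1 hi
    rcases hij with rfl | hij
    · exact hiA (h2 hj)
    · exact hij (mul_comm (q j i) (q i j) ▸ hc j ⟨.inr hj, h2 hj⟩ i ⟨.inl hi, hiA⟩)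
  · exact Set.disjoint_left.mp (h1.union_left h2) hx hxA

/-- If `s ∪ b` and `s` are connected, and no edge leads from `b ∩ A` to `b \ A`, then `s ∪ (b ∩ A)`
is connected: every part of `b ∩ A` is joined to `s`. -/
theorem CutConnected.union_inter {s b A : Set (Fin n)} (hs : CutConnected q s)
    (hsb : CutConnected q (s ∪ b))
    (h : ∀ i ∈ b ∩ A, ∀ j ∈ b \ A, q i j * q j i = 1) : CutConnected q (s ∪ b ∩ A) := by
  -- A part `D` of `b ∩ A` that is cut off from the rest and from `s` is also cut off from `b \ A`.
  have key : ∀ D : Set (Fin n), D.Nonempty → D ⊆ b ∩ A → Disjoint s D →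
      ∃ i ∈ D, ∃ j ∈ (s ∪ b ∩ A) \ D, q i j * q j i ≠ 1 := by
    intro D hD hDb hDs
    obtain ⟨z, hz⟩ := hs.1
    obtain ⟨x, hx⟩ := hD
    obtain ⟨i, ⟨-, hi⟩, j, ⟨hj, hj'⟩, hij⟩ := hsb.2 D ⟨x, .inr (hDb hx).1, hx⟩
      ⟨z, .inl hz, Set.disjoint_left.mp hDs hz⟩
    refine ⟨i, hi, j, ⟨?_, hj'⟩, hij⟩
    rcases hj with hj | hj
    · exact .inl hj
    · by_cases hjA : j ∈ A
      · exact .inr ⟨hj, hjA⟩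
      · exact absurd (h i (hDb hi) j ⟨hj, hjA⟩) hij
  refine ⟨hs.1.inl, fun C hC hC' => ?_⟩
  by_contra! hc
  rcases hs.subset_or_disjoint fun x hx y hy => hc x ⟨.inl hx.1, hx.2⟩ y ⟨.inl hy.1, hy.2⟩
    with h1 | h1
  · obtain ⟨i, hi, j, hj, hij⟩ := key ((s ∪ b ∩ A) \ C) hC'
      (fun x hx => hx.1.resolve_left fun hxs => hx.2 (h1 hxs))
      (Set.disjoint_left.mpr fun x hx hx' => hx'.2 (h1 hx))
    refine hij (mul_comm (q j i) (q i j) ▸ hc j ⟨hj.1, ?_⟩ i hi)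
    by_contra hjC
    exact hj.2 ⟨hj.1, hjC⟩
  · obtain ⟨i, hi, j, hj, hij⟩ := key ((s ∪ b ∩ A) ∩ C) hC
      (fun x hx => hx.1.resolve_left fun hxs => Set.disjoint_left.mp h1 hxs hx.2)
      (Set.disjoint_left.mpr fun x hx hx' => Set.disjoint_left.mp h1 hx hx'.2)
    exact hij (hc i hi j ⟨hj.1, fun hjC => hj.2 ⟨hj.1, hjC⟩⟩)

theorem CutConnected.exists_adj {s : Set (Fin n)} (hs : CutConnected q s) {i k : Fin n}
    (hi : i ∈ s) (hk : k ∈ s) (hik : i ≠ k) : ∃ j ∈ s, i ≠ j ∧ q i j * q j i ≠ 1 := by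
  obtain ⟨x, ⟨-, rfl⟩, j, ⟨hj, hj'⟩, hij⟩ := hs.2 {i} ⟨i, hi, rfl⟩ ⟨k, hk, hik.symm⟩
  exact ⟨j, hj, fun h => hj' h.symm, hij⟩

end NicholsDiag

/-! ### The multigrading of the Nichols algebra -/

namespace NicholsDiag

variable {F : Type*} [Field F] {n : ℕ} (q : Fin n → Fin n → Fˣ)

/-- The projection of `T(V)` onto its component of multidegree `d`. -/
noncomputable def tensorProj (F : Type*) [Field F] (d : Fin n → ℕ) :
    FreeAlgebra F (Fin n) →ₗ[F] FreeAlgebra F (Fin n) :=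
  (FreeAlgebra.basisFreeMonoid F (Fin n)).constr F fun w =>
    if wordDeg w.toList = d then tensorWord F w.toList else 0

theorem tensorProj_tensorWord (d : Fin n → ℕ) (w : List (Fin n)) :
    tensorProj F d (tensorWord F w) = if wordDeg w = d then tensorWord F w else 0 := by
  have := basisFreeMonoid_apply (F := F) (FreeMonoid.ofList w)
  rw [FreeMonoid.toList_ofList] at this
  rw [← this, tensorProj, Module.Basis.constr_basis, this, FreeMonoid.toList_ofList]

theorem wordDeg_ofFn_get (w : List (Fin n)) (σ : Equiv.Perm (Fin w.length)) :
    wordDeg (List.ofFn fun k => w.get (σ k)) = wordDeg w := by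
  refine wordDeg_eq_of_perm ?_
  have h := Equiv.Perm.ofFn_comp_perm σ w.get
  rw [List.ofFn_get] at h
  exact h

/-- The quantum symmetrizer preserves the multidegree. -/
theorem quantumSymmetrizer_tensorProj (d : Fin n → ℕ) (a : FreeAlgebra F (Fin n)) :
    quantumSymmetrizer q (tensorProj F d a) = tensorProj F d (quantumSymmetrizer q a) := by
  have : quantumSymmetrizer q ∘ₗ tensorProj F d = tensorProj F d ∘ₗ quantumSymmetrizer q := by
    refine linearMap_ext_tensorWord fun w => ?_
    rw [LinearMap.comp_apply, LinearMap.comp_apply, tensorProj_tensorWord,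
      quantumSymmetrizer_tensorWord, map_sum]
    simp only [braidAct, map_smul, tensorProj_tensorWord, wordDeg_ofFn_get]
    split_ifs with h
    · rw [quantumSymmetrizer_tensorWord]; rfl
    · simp
  exact LinearMap.congr_fun this a

/-- The coaction of `ℕ₀ⁿ` on `T(V)` with values in `𝔅(V)`: the letter `x_i` is sent to `x_i` in
degree `e_i`. -/
noncomputable def tensorCoaction :
    FreeAlgebra F (Fin n) →ₐ[F] AddMonoidAlgebra (NicholsAlgebra q) (Fin n → ℕ) :=
  FreeAlgebra.lift F fun i => AddMonoidAlgebra.single (wordDeg [i]) (monomial q [i])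

theorem tensorCoaction_tensorWord (w : List (Fin n)) :
    tensorCoaction q (tensorWord F w) = AddMonoidAlgebra.single (wordDeg w) (monomial q w) := by
  induction w with
  | nil =>
    have h : wordDeg ([] : List (Fin n)) = 0 := by funext i; simp [wordDeg]
    simp [tensorWord, monomial, h, AddMonoidAlgebra.one_def]
  | cons i w ih =>
    have h : tensorWord F (i :: w) = FreeAlgebra.ι F i * tensorWord F w := by simp [tensorWord]
    rw [h, map_mul, ih, tensorCoaction, FreeAlgebra.lift_ι_apply,
      AddMonoidAlgebra.single_mul_single, ← wordDeg_cons, ← monomial_cons]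

theorem coeff_tensorCoaction (d : Fin n → ℕ) (a : FreeAlgebra F (Fin n)) :
    (tensorCoaction q a).coeff d = RingQuot.mkAlgHom F
      (fun a b : FreeAlgebra F (Fin n) => quantumSymmetrizer q a = quantumSymmetrizer q b)
      (tensorProj F d a) := by
  have : (Finsupp.lapply d ∘ₗ (AddMonoidAlgebra.coeffLinearEquiv F).toLinearMap ∘ₗ
      (tensorCoaction q).toLinearMap) = (RingQuot.mkAlgHom F
      (fun a b : FreeAlgebra F (Fin n) =>
        quantumSymmetrizer q a = quantumSymmetrizer q b)).toLinearMap ∘ₗ tensorProj F d := by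
    refine linearMap_ext_tensorWord fun w => ?_
    simp only [LinearMap.comp_apply, AlgHom.toLinearMap_apply, tensorCoaction_tensorWord,
      tensorProj_tensorWord]
    change (Finsupp.single (wordDeg w) (monomial q w)) d = _
    rw [Finsupp.single_apply]
    split_ifs
    · rfl
    · simp
  exact LinearMap.congr_fun this a

/-- The coaction of `ℕ₀ⁿ` on `𝔅(V)` that defines its grading. -/
noncomputable def coaction :
    NicholsAlgebra q →ₐ[F] AddMonoidAlgebra (NicholsAlgebra q) (Fin n → ℕ) :=
  RingQuot.liftAlgHom F ⟨tensorCoaction q, fun a b h => by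
    refine AddMonoidAlgebra.coeff_injective (Finsupp.ext fun d => ?_)
    rw [coeff_tensorCoaction, coeff_tensorCoaction]
    refine mkAlgHom_eq_of_quantumSymmetrizer_eq q ?_
    rw [quantumSymmetrizer_tensorProj, quantumSymmetrizer_tensorProj, h]⟩

theorem coaction_monomial (w : List (Fin n)) :
    coaction q (monomial q w) = AddMonoidAlgebra.single (wordDeg w) (monomial q w) := by
  rw [coaction, monomial, RingQuot.liftAlgHom_mkAlgHom_apply, tensorCoaction_tensorWord]
  rfl

theorem coaction_of_mem_homogeneousPart {d : Fin n → ℕ} {x : NicholsAlgebra q}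
    (hx : x ∈ homogeneousPart q d) : coaction q x = AddMonoidAlgebra.single d x := by
  induction hx using Submodule.span_induction with
  | mem x h =>
    obtain ⟨w, rfl, rfl⟩ := h
    exact coaction_monomial q w
  | zero => simp
  | add x y _ _ hx hy => rw [map_add, hx, hy, AddMonoidAlgebra.single_add]
  | smul c x _ hx => rw [map_smul, hx, AddMonoidAlgebra.smul_single]

/-- A nonzero homogeneous element has only one multidegree. -/
theorem homogeneousPart_degree_unique {d e : Fin n → ℕ} {x : NicholsAlgebra q} (hx0 : x ≠ 0)
    (hd : x ∈ homogeneousPart q d) (he : x ∈ homogeneousPart q e) : d = e := by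
  have h := congrArg (fun a => a.coeff d) ((coaction_of_mem_homogeneousPart q hd).symm.trans
    (coaction_of_mem_homogeneousPart q he))
  simp only [AddMonoidAlgebra.coeff_single, Finsupp.single_apply, if_true] at h
  by_contra hne
  rw [if_neg (Ne.symm hne)] at h
  exact hx0 h

theorem mul_mem_homogeneousPart {d e : Fin n → ℕ} {x y : NicholsAlgebra q}
    (hx : x ∈ homogeneousPart q d) (hy : y ∈ homogeneousPart q e) :
    x * y ∈ homogeneousPart q (d + e) := by
  induction hx, hy using Submodule.span_induction₂ with
  | mem_mem x y hx hy =>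
    obtain ⟨u, rfl, rfl⟩ := hx
    obtain ⟨v, rfl, rfl⟩ := hy
    rw [← monomial_append, ← wordDeg_append]
    exact monomial_mem_homogeneousPart q _
  | zero_left y _ => rw [zero_mul]; exact zero_mem _
  | zero_right x _ => rw [mul_zero]; exact zero_mem _
  | add_left x y z _ _ _ hx hy => rw [add_mul]; exact add_mem hx hy
  | add_right x y z _ _ _ hx hy => rw [mul_add]; exact add_mem hx hy
  | smul_left c x y _ _ h => rw [smul_mul_assoc]; exact Submodule.smul_mem _ _ h
  | smul_right c x y _ _ h => rw [mul_smul_comm]; exact Submodule.smul_mem _ _ h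

theorem braidedBracket_mem_homogeneousPart {d e : Fin n → ℕ} {x y : NicholsAlgebra q}
    (hx : x ∈ homogeneousPart q d) (hy : y ∈ homogeneousPart q e) :
    braidedBracket q d e x y ∈ homogeneousPart q (d + e) :=
  sub_mem (add_comm e d ▸ mul_mem_homogeneousPart q hy hx)
    (Submodule.smul_mem _ _ (mul_mem_homogeneousPart q hx hy))

/-- The letters that occur in degree `d`. -/
def degSupport (d : Fin n → ℕ) : Set (Fin n) := {i | d i ≠ 0}

theorem degSupport_wordDeg (w : List (Fin n)) : degSupport (wordDeg w) = {i | i ∈ w} :=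
  Set.ext fun _ => wordDeg_ne_zero_iff

theorem degSupport_add (d e : Fin n → ℕ) :
    degSupport (d + e) = degSupport d ∪ degSupport e := by
  ext i
  simp only [degSupport, Pi.add_apply, ne_eq, Nat.add_eq_zero_iff, Set.mem_ofPred_eq, Set.mem_union]
  tauto

/-- The bracket of homogeneous elements vanishes if every letter of the one commutes, up to the
braiding, with every letter of the other. -/
theorem braidedBracket_eq_zero {d e : Fin n → ℕ} {x y : NicholsAlgebra q}
    (hx : x ∈ homogeneousPart q d) (hy : y ∈ homogeneousPart q e)
    (h : ∀ i ∈ degSupport d, ∀ j ∈ degSupport e, q i j * q j i = 1) :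
    braidedBracket q d e x y = 0 := by
  unfold braidedBracket
  rw [sub_eq_zero]
  induction hx, hy using Submodule.span_induction₂ with
  | mem_mem x y hx hy =>
    obtain ⟨u, rfl, rfl⟩ := hx
    obtain ⟨v, rfl, rfl⟩ := hy
    rw [degSupport_wordDeg, degSupport_wordDeg] at h
    rw [← monomial_append, ← monomial_append]
    exact monomial_append_comm q fun i hi j hj => mul_comm (q j i) (q i j) ▸ h j hj i hi
  | zero_left y _ => simp
  | zero_right x _ => simp
  | add_left x y z _ _ _ hx hy => rw [mul_add, add_mul, smul_add, hx, hy]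
  | add_right x y z _ _ _ hx hy => rw [mul_add, add_mul, smul_add, hx, hy]
  | smul_left c x y _ _ h => rw [mul_smul_comm, smul_mul_assoc, h, smul_comm]
  | smul_right c x y _ _ h => rw [mul_smul_comm, smul_mul_assoc, h, smul_comm]

end NicholsDiag

namespace NicholsDiag

variable {F : Type*} [Field F] {n : ℕ} (q : Fin n → Fin n → Fˣ)

/-! ### Elements of `𝔏(V)` have connected support -/

theorem letter_mem_nicholsBraidedLie (i : Fin n) : monomial q [i] ∈ nicholsBraidedLie q :=
  Submodule.mem_sInf.mpr fun _ hW => hW.1 i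

theorem bracketClosed_nicholsBraidedLie : BracketClosed q (nicholsBraidedLie q) := by
  intro d e x y hx hy hxd hye
  exact Submodule.mem_sInf.mpr fun W hW => hW.2 d e x y (Submodule.mem_sInf.mp hx W hW)
    (Submodule.mem_sInf.mp hy W hW) hxd hye

/-- The elements of `𝔅(V)` all of whose homogeneous components have connected support. -/
noncomputable def connectedPart : Submodule F (NicholsAlgebra q) where
  carrier := {x | ∀ d, ¬ CutConnected q (degSupport d) → (coaction q x).coeff d = 0}
  zero_mem' d _ := by simp
  add_mem' {x y} hx hy d hd := by
    rw [map_add, AddMonoidAlgebra.coeff_add, Finsupp.add_apply, hx d hd, hy d hd, add_zero]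
  smul_mem' c x hx d hd := by
    rw [map_smul, AddMonoidAlgebra.coeff_smul, Finsupp.smul_apply, hx d hd, smul_zero]

theorem mem_connectedPart_iff {d : Fin n → ℕ} {x : NicholsAlgebra q}
    (hx : x ∈ homogeneousPart q d) :
    x ∈ connectedPart q ↔ x ≠ 0 → CutConnected q (degSupport d) := by
  change (∀ e, ¬ CutConnected q (degSupport e) → (coaction q x).coeff e = 0) ↔ _
  rw [coaction_of_mem_homogeneousPart q hx]
  simp only [AddMonoidAlgebra.coeff_single, Finsupp.single_apply]
  constructor
  · intro h hx0
    by_contra hd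
    exact hx0 (by simpa using h d hd)
  · intro h e he
    split_ifs with hde
    · subst hde
      by_contra hx0
      exact he (h hx0)
    · rfl

theorem bracketClosed_connectedPart : BracketClosed q (connectedPart q) := by
  intro d e x y hx hy hxd hye
  rw [mem_connectedPart_iff q (braidedBracket_mem_homogeneousPart q hxd hye)]
  rw [mem_connectedPart_iff q hxd] at hx
  rw [mem_connectedPart_iff q hye] at hy
  intro h0
  have hd := hx (by rintro rfl; simp [braidedBracket] at h0)
  have he := hy (by rintro rfl; simp [braidedBracket] at h0)
  rw [degSupport_add]
  by_contra hc
  refine h0 (braidedBracket_eq_zero q hxd hye fun i hi j hj => ?_)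
  by_contra hij
  exact hc (hd.union he hi hj (.inr hij))

theorem cutConnected_of_mem_nicholsBraidedLie {d : Fin n → ℕ} {x : NicholsAlgebra q}
    (hx0 : x ≠ 0) (hx : x ∈ homogeneousPart q d) (hL : x ∈ nicholsBraidedLie q) :
    CutConnected q (degSupport d) := by
  refine (mem_connectedPart_iff q hx).mp
    (Submodule.mem_sInf.mp hL _ ⟨fun i => ?_, bracketClosed_connectedPart q⟩) hx0
  rw [mem_connectedPart_iff q (monomial_mem_homogeneousPart q [i]), degSupport_wordDeg]
  intro _
  simpa using cutConnected_singleton (q := q) i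

/-! ### Powers of a letter -/

/-- The product of `c` over all inversions of `σ`. -/
def inversionProd (c : F) {k : ℕ} (σ : Equiv.Perm (Fin k)) : F :=
  ∏ a : Fin k, ∏ b : Fin k, if a < b ∧ σ b < σ a then c else 1

/-- The permutation of `k + 1` letters that sends `0` to `p` and acts on the rest as `σ`, up to
monotone relabelling. -/
def permCons {k : ℕ} (p : Fin (k + 1)) (σ : Equiv.Perm (Fin k)) : Equiv.Perm (Fin (k + 1)) :=
  (Equiv.Perm.decomposeFin.symm (0, σ)).trans p.cycleRange.symm

theorem permCons_zero {k : ℕ} (p : Fin (k + 1)) (σ : Equiv.Perm (Fin k)) :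
    permCons p σ 0 = p := by
  simp [permCons]

theorem permCons_succ {k : ℕ} (p : Fin (k + 1)) (σ : Equiv.Perm (Fin k)) (a : Fin k) :
    permCons p σ a.succ = p.succAbove (σ a) := by
  simp [permCons]

theorem permCons_bijective (k : ℕ) :
    Function.Bijective fun x : Fin (k + 1) × Equiv.Perm (Fin k) => permCons x.1 x.2 := by
  rw [Fintype.bijective_iff_injective_and_card]
  refine ⟨?_, Fintype.card_congr Equiv.Perm.decomposeFin.symm⟩
  rintro ⟨p, σ⟩ ⟨p', σ'⟩ h
  have h0 : p = p' := by simpa only [permCons_zero] using Equiv.congr_fun h 0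
  subst h0
  refine Prod.ext rfl (Equiv.ext fun a => ?_)
  have ha := Equiv.congr_fun h a.succ
  simp only [permCons_succ] at ha
  exact Fin.succAbove_right_injective ha

theorem inversionProd_permCons (c : F) {k : ℕ} (p : Fin (k + 1)) (σ : Equiv.Perm (Fin k)) :
    inversionProd c (permCons p σ) = c ^ (p : ℕ) * inversionProd c σ := by
  unfold inversionProd
  rw [Fin.prod_univ_succ]
  congr 1
  · rw [Fin.prod_univ_succ]
    simp only [permCons_zero, permCons_succ, lt_irrefl, false_and, if_false, one_mul,
      Fin.succ_pos, true_and]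
    rw [Equiv.prod_comp σ fun b => if p.succAbove b < p then c else 1, Finset.prod_ite,
      Finset.prod_const, Finset.prod_const_one, mul_one]
    congr 1
    simp only [Fin.succAbove_lt_iff_castSucc_lt]
    simp [Fin.lt_def, Fin.card_filter_val_lt, Nat.lt_succ_iff.mp p.2]
  · refine Finset.prod_congr rfl fun a _ => ?_
    rw [Fin.prod_univ_succ]
    simp [permCons_succ]

theorem sum_inversionProd_succ (c : F) (k : ℕ) :
    ∑ σ : Equiv.Perm (Fin (k + 1)), inversionProd c σ =
      (∑ p ∈ Finset.range (k + 1), c ^ p) * ∑ σ : Equiv.Perm (Fin k), inversionProd c σ := by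
  rw [← (permCons_bijective k).sum_comp, Fintype.sum_prod_type]
  simp only [inversionProd_permCons]
  rw [← Fin.sum_univ_eq_sum_range (fun p => c ^ p), Finset.sum_mul_sum]

theorem sum_inversionProd_eq_zero {c : F} (hc : c ≠ 1) {k : ℕ} (hk : k ≠ 0) (hck : c ^ k = 1) :
    ∑ σ : Equiv.Perm (Fin k), inversionProd c σ = 0 := by
  obtain ⟨k, rfl⟩ := Nat.exists_eq_succ_of_ne_zero hk
  rw [sum_inversionProd_succ, geom_sum_eq hc, hck, sub_self, zero_div, zero_mul]

/-- On powers of one letter the quantum symmetrizer acts by the quantum factorial. -/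
theorem quantumSymmetrizer_replicate (i : Fin n) (k : ℕ) :
    quantumSymmetrizer q (tensorWord F (List.replicate k i)) =
      (∑ σ : Equiv.Perm (Fin k), inversionProd (q i i : F) σ) •
        tensorWord F (List.replicate k i) := by
  have key : ∀ (w : List (Fin n)) (hw : ∀ j ∈ w, j = i) (m : ℕ) (hm : w.length = m),
      ∑ σ : Equiv.Perm (Fin w.length), braidAct q w σ =
        (∑ σ : Equiv.Perm (Fin m), inversionProd (q i i : F) σ) • tensorWord F w := by
    rintro w hw _ rfl
    rw [Finset.sum_smul]
    refine Finset.sum_congr rfl fun σ _ => ?_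
    have hget : ∀ a, w.get a = i := fun a => hw _ (List.get_mem w a)
    have h1 : (braidCoeff q w σ : F) = inversionProd (q i i : F) σ := by
      simp only [braidCoeff, inversionProd, hget, Units.coe_prod, apply_ite Units.val,
        Units.val_one]
    have h2 : (List.ofFn fun a => w.get (σ.symm a)) = w := by
      rw [show (fun a => w.get (σ.symm a)) = w.get from funext fun a => by rw [hget, hget],
        List.ofFn_get]
    rw [braidAct, h1, h2]
  rw [quantumSymmetrizer_tensorWord]
  exact key _ (fun j hj => List.eq_of_mem_replicate hj) k (List.length_replicate ..)

theorem monomial_replicate_eq_zero {i : Fin n} (hi : q i i ≠ 1) {k : ℕ} (hk : k ≠ 0)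
    (hik : q i i ^ k = 1) : monomial q (List.replicate k i) = 0 := by
  have h : quantumSymmetrizer q (tensorWord F (List.replicate k i)) = quantumSymmetrizer q 0 := by
    rw [quantumSymmetrizer_replicate, sum_inversionProd_eq_zero (by simpa using hi) hk
      (by rw [← Units.val_pow_eq_pow_val, hik, Units.val_one]), zero_smul, map_zero]
  have := mkAlgHom_eq_of_quantumSymmetrizer_eq q h
  rwa [map_zero] at this

/-! ### Brackets as rotations -/

/-- The word `u ++ v` may be rotated to `v ++ u` modulo `𝔏(V)`, with the factor `χ` of the
bracket. -/
def Rotates (u v : List (Fin n)) : Prop :=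
  monomial q (u ++ v) - (chi q (wordDeg u) (wordDeg v) : F) • monomial q (v ++ u) ∈
    nicholsBraidedLie q

theorem rotates_nil (u : List (Fin n)) : Rotates q u [] := by simp [Rotates]

theorem rotates_of_mem {u v : List (Fin n)} (hu : monomial q u ∈ nicholsBraidedLie q)
    (hv : monomial q v ∈ nicholsBraidedLie q) : Rotates q u v := by
  have := bracketClosed_nicholsBraidedLie q (wordDeg v) (wordDeg u) _ _ hv hu
    (monomial_mem_homogeneousPart q v) (monomial_mem_homogeneousPart q u)
  rwa [braidedBracket, ← monomial_append, ← monomial_append] at this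

theorem chi_wordDeg_replicate (i : Fin n) (k : ℕ) :
    chi q (wordDeg [i]) (wordDeg (List.replicate k i)) = q i i ^ k := by
  induction k with
  | zero => simp
  | succ k ih =>
    rw [List.replicate_succ, wordDeg_cons i (List.replicate k i), chi_add_right, ih, chi_singleton,
      pow_succ']

theorem monomial_replicate_mem {i : Fin n} (hi : q i i ≠ 1) (k : ℕ) :
    monomial q (List.replicate (k + 1) i) ∈ nicholsBraidedLie q := by
  induction k with
  | zero => exact letter_mem_nicholsBraidedLie q i
  | succ k ih =>
    by_cases h : q i i ^ (k + 1) = 1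
    · rw [List.replicate_succ, monomial_cons, monomial_replicate_eq_zero q hi (by simp) h, mul_zero]
      exact zero_mem _
    · have h1 := rotates_of_mem q (letter_mem_nicholsBraidedLie q i) ih
      unfold Rotates at h1
      rw [chi_wordDeg_replicate, ← List.replicate_succ', List.singleton_append,
        ← List.replicate_succ] at h1
      have h2 : (1 - (q i i ^ (k + 1) : Fˣ) : F) • monomial q (List.replicate (k + 1 + 1) i) ∈
          nicholsBraidedLie q := by
        have h3 := sub_smul (1 : F) (q i i ^ (k + 1) : Fˣ)
          (monomial q (List.replicate (k + 1 + 1) i))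
        rw [one_smul] at h3
        exact h3 ▸ h1
      exact (Submodule.smul_mem_iff _ (sub_ne_zero.mpr fun h' =>
        h (Units.val_injective (by rw [← h', Units.val_one])))).mp h2

end NicholsDiag

/-! ### Rotation of connected words -/

namespace NicholsDiag

variable {F : Type*} [Field F] {n : ℕ} (q : Fin n → Fin n → Fˣ)

theorem setOf_mem_append (u v : List (Fin n)) :
    {i | i ∈ u ++ v} = {i | i ∈ u} ∪ {i | i ∈ v} := by
  ext; simp

/-- The words of length less than `N` that are connected and have at least two different letters
lie in `𝔏(V)`. -/
def ConnectedWordsMem (N : ℕ) : Prop :=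
  ∀ w : List (Fin n), w.length < N → CutConnected q {i | i ∈ w} → (∃ i ∈ w, ∃ j ∈ w, i ≠ j) →
    monomial q w ∈ nicholsBraidedLie q

variable {q}

/-- Rotating a block `v` that consists of two commuting blocks can be done in two steps. -/
theorem Rotates.of_split {u v v₁ v₂ : List (Fin n)} {c : Fˣ}
    (hv : monomial q v = (c : F) • monomial q (v₁ ++ v₂))
    (hd : wordDeg v = wordDeg v₁ + wordDeg v₂)
    (hχ : chi q (wordDeg v₁) (wordDeg v₂) * chi q (wordDeg v₂) (wordDeg v₁) = 1)
    (h₁ : Rotates q (u ++ v₁) v₂) (h₂ : Rotates q (v₂ ++ u) v₁) : Rotates q u v := by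
  unfold Rotates at *
  have h3 := Submodule.smul_mem _ (c : F) (add_mem h₁ (Submodule.smul_mem _
    (chi q (wordDeg (u ++ v₁)) (wordDeg v₂) : F) h₂))
  have hscal : chi q (wordDeg (u ++ v₁)) (wordDeg v₂) * chi q (wordDeg (v₂ ++ u)) (wordDeg v₁) =
      chi q (wordDeg u) (wordDeg v) := by
    rw [hd, wordDeg_append, wordDeg_append, chi_add_left, chi_add_left, chi_add_right,
      ← mul_one (chi q (wordDeg u) (wordDeg v₁) * _), ← hχ]
    ac_rfl
  rw [monomial_append q u v, monomial_append q v u, hv, mul_smul_comm, smul_mul_assoc,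
    ← monomial_append, ← monomial_append, ← hscal, Units.val_mul]
  rw [List.append_assoc, List.append_assoc, smul_sub, smul_smul, sub_add_sub_cancel, smul_sub,
    smul_comm] at h3
  rwa [List.append_assoc]

/-- Let `u ++ v` be a connected word of length at most `N`, with `u` connected. If `v` is not in
`𝔏(V)`, it is a product of two commuting blocks `v₁`, `v₂`, up to a nonzero scalar, such that `u`
together with either block is connected and has at least two different letters. -/
theorem exists_split {N : ℕ} (hN : ConnectedWordsMem q N) {u v : List (Fin n)}
    (huv : (u ++ v).length ≤ N) (hu : CutConnected q {i | i ∈ u})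
    (hc : CutConnected q {i | i ∈ u ++ v}) (h2 : ∃ i ∈ u ++ v, ∃ j ∈ u ++ v, i ≠ j)
    (hv0 : v ≠ []) (hv : monomial q v ∉ nicholsBraidedLie q) :
    ∃ (v₁ v₂ : List (Fin n)) (c : Fˣ), v₁ ≠ [] ∧ v₂ ≠ [] ∧ v.Perm (v₁ ++ v₂) ∧
      monomial q v = (c : F) • monomial q (v₁ ++ v₂) ∧
      chi q (wordDeg v₁) (wordDeg v₂) * chi q (wordDeg v₂) (wordDeg v₁) = 1 ∧
      CutConnected q {i | i ∈ u ++ v₁} ∧ CutConnected q {i | i ∈ v₂ ++ u} ∧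
      (∃ i ∈ u ++ v₁, ∃ j ∈ u ++ v₁, i ≠ j) ∧ ∃ i ∈ v₂ ++ u, ∃ j ∈ v₂ ++ u, i ≠ j := by
  classical
  have hu0 : u ≠ [] := by
    rintro rfl
    obtain ⟨i, hi⟩ := hu.1
    exact List.not_mem_nil hi
  by_cases hcv : CutConnected q {i | i ∈ v}
  · -- Here `v` is a power of a letter `l` with `q l l = 1`.
    have hvl : ¬ ∃ i ∈ v, ∃ j ∈ v, i ≠ j := fun h => hv (hN v (by
      have := List.length_pos_iff.mpr hu0
      rw [List.length_append] at huv
      omega) hcv h)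
    push Not at hvl
    obtain ⟨l, v', rfl⟩ := List.exists_cons_of_ne_nil hv0
    have hl : ∀ j ∈ v', j = l := fun j hj => hvl j (by simp [hj]) l (by simp)
    have hv' : v' ≠ [] := by
      rintro rfl
      exact hv (letter_mem_nicholsBraidedLie q l)
    have hql : q l l = 1 := by
      by_contra hql
      refine hv ?_
      rw [List.eq_replicate_of_mem hl, ← List.replicate_succ]
      exact monomial_replicate_mem q hql _
    have hlv' : l ∈ v' := by
      obtain ⟨j, hj⟩ := List.exists_mem_of_ne_nil v' hv'
      exact hl j hj ▸ hj
    have e1 : ∀ i, i ∈ u ++ [l] ↔ i ∈ u ++ l :: v' := fun i => by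
      simp only [List.mem_append, List.mem_cons, List.not_mem_nil, or_false]
      exact ⟨fun h => h.imp_right .inl, fun h => h.imp_right fun h => h.elim id (hl i)⟩
    have e2 : ∀ i, i ∈ v' ++ u ↔ i ∈ u ++ l :: v' := fun i => by
      simp only [List.mem_append, List.mem_cons]
      refine ⟨fun h => h.symm.imp_right .inr, fun h => h.symm.imp_left fun h => ?_⟩
      exact h.elim (fun h => h ▸ hlv') id
    refine ⟨[l], v', 1, by simp, hv', .refl _, by simp, ?_, ?_, ?_, ?_, ?_⟩
    · refine chi_mul_chi_eq_one q fun i hi j hj => ?_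
      rw [List.mem_singleton.mp hi, hl j hj, hql, one_mul]
    · simpa only [e1] using hc
    · simpa only [e2] using hc
    · simpa only [e1] using h2
    · simpa only [e2] using h2
  · -- Here `v` is disconnected, and is sorted along a cut that no edge crosses.
    rw [CutConnected, not_and] at hcv
    have := hcv (List.exists_mem_of_ne_nil v hv0)
    push Not at this
    obtain ⟨A, ⟨x, hx, hxA⟩, ⟨y, hy, hyA⟩, hcut⟩ := this
    have hcut' : ∀ i ∈ v, ∀ j ∈ v, i ∈ A → j ∉ A → q i j * q j i = 1 :=
      fun i hi j hj hiA hjA => hcut i ⟨hi, hiA⟩ j ⟨hj, hjA⟩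
    obtain ⟨c, hc'⟩ := exists_monomial_eq_smul_filter q A hcut'
    have e1 : {i | i ∈ v.filter (· ∈ A)} = {i | i ∈ v} ∩ A := by ext; simp
    have e2 : {i | i ∈ v.filter (· ∉ A)} = {i | i ∈ v} ∩ Aᶜ := by ext; simp
    rw [setOf_mem_append] at hc
    have c1 := hu.union_inter hc hcut
    have c2 := hu.union_inter (A := Aᶜ) hc fun i hi j hj => by
      rw [mul_comm]
      exact hcut j ⟨hj.1, not_not.mp hj.2⟩ i hi
    -- If `u` and one block had only one letter in common, the other block would be cut off.
    have two : ∀ (B : Set (Fin n)) (z w : Fin n), z ∈ v → z ∈ B → w ∈ v → w ∉ B →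
        (∀ i ∈ v, ∀ j ∈ v, i ∈ B → j ∉ B → q i j * q j i = 1) →
        ∃ i ∈ {i | i ∈ u} ∪ {i | i ∈ v} ∩ B, ∃ j ∈ {i | i ∈ u} ∪ {i | i ∈ v} ∩ B, i ≠ j := by
      intro B z w hz hzB hw hwB hB
      by_contra! hone
      have hzi : ∀ i ∈ u, i = z := fun i hi => hone i (.inl hi) z (.inr ⟨hz, hzB⟩)
      obtain ⟨i, ⟨-, hi⟩, j, ⟨hj, hjz⟩, hij⟩ := hc.2 {z} ⟨z, .inr hz, rfl⟩
        ⟨w, .inr hw, fun h => hwB (h ▸ hzB)⟩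
      have hjv : j ∈ v := hj.resolve_left fun hj => hjz (hzi j hj)
      rw [Set.mem_singleton_iff.mp hi] at hij
      refine hij (hB z hz j hjv hzB fun hjB => ?_)
      exact hjz (hone j (.inr ⟨hjv, hjB⟩) z (.inr ⟨hz, hzB⟩))
    have t1 := two A x y hx hxA hy hyA hcut'
    have t2 := two Aᶜ y x hy hyA hx (not_not.mpr hxA) fun i hi j hj hiA hjA => by
      rw [mul_comm]
      exact hcut' j hj i hi (not_not.mp hjA) hiA
    rw [← e1, ← setOf_mem_append] at c1 t1
    rw [← e2, Set.union_comm, ← setOf_mem_append] at c2 t2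
    refine ⟨_, _, c, ?_, ?_, ?_, hc', ?_, c1, c2, t1, t2⟩
    · exact List.ne_nil_of_mem (List.mem_filter.mpr ⟨hx, by simpa using hxA⟩)
    · exact List.ne_nil_of_mem (List.mem_filter.mpr ⟨hy, by simpa using hyA⟩)
    · have := (List.filter_append_perm (fun i => decide (i ∈ A)) v).symm
      simpa using this
    · refine chi_mul_chi_eq_one q fun i hi j hj => ?_
      simp only [List.mem_filter, decide_eq_true_eq] at hi hj
      exact hcut' i hi.1 j hj.1 hi.2 hj.2

/-- A connected block can be rotated to the end of a connected word. -/
theorem rotates_of_connected {N : ℕ} (hN : ConnectedWordsMem q N) {u v : List (Fin n)}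
    (huv : (u ++ v).length ≤ N) (hu : CutConnected q {i | i ∈ u})
    (hc : CutConnected q {i | i ∈ u ++ v}) (h2 : ∃ i ∈ u ++ v, ∃ j ∈ u ++ v, i ≠ j)
    (huL : monomial q u ∈ nicholsBraidedLie q) : Rotates q u v := by
  induction hk : v.length using Nat.strong_induction_on generalizing u v with
  | _ k ih =>
  subst hk
  by_cases hv0 : v = []
  · rw [hv0]; exact rotates_nil q u
  by_cases hv : monomial q v ∈ nicholsBraidedLie q
  · exact rotates_of_mem q huL hv
  obtain ⟨v₁, v₂, c, hv₁, hv₂, hperm, hmon, hχ, c1, c2, t1, t2⟩ :=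
    exists_split hN huv hu hc h2 hv0 hv
  have hl1 := List.length_pos_iff.mpr hv₁
  have hl2 := List.length_pos_iff.mpr hv₂
  have hl := hperm.length_eq
  rw [List.length_append] at huv hl
  have p1 : (u ++ v).Perm ((u ++ v₁) ++ v₂) := by
    rw [List.append_assoc]; exact hperm.append_left u
  have p2 : (u ++ v).Perm ((v₂ ++ u) ++ v₁) :=
    p1.trans ((List.perm_append_comm).trans (by rw [List.append_assoc]))
  refine Rotates.of_split hmon (by rw [wordDeg_eq_of_perm hperm, wordDeg_append]) hχ ?_ ?_
  · refine ih v₂.length (by omega) ?_ c1 ?_ ?_ ?_ rfl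
    · rw [← p1.length_eq, List.length_append]; exact huv
    · simpa only [p1.mem_iff] using hc
    · simpa only [p1.mem_iff] using h2
    · exact hN _ (by rw [List.length_append]; omega) c1 t1
  · refine ih v₁.length (by omega) ?_ c2 ?_ ?_ ?_ rfl
    · rw [← p2.length_eq, List.length_append]; exact huv
    · simpa only [p2.mem_iff] using hc
    · simpa only [p2.mem_iff] using h2
    · exact hN _ (by rw [List.length_append]; omega) c2 t2

theorem Rotates.mem_of_mem {u v : List (Fin n)} (h : Rotates q u v)
    (hv : monomial q (v ++ u) ∈ nicholsBraidedLie q) :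
    monomial q (u ++ v) ∈ nicholsBraidedLie q := by
  have := add_mem h (Submodule.smul_mem _ (chi q (wordDeg u) (wordDeg v) : F) hv)
  rwa [sub_add_cancel] at this

/-- Rotating two adjacent letters one by one and rotating them as a block gives factors that
differ by `q_{ij} q_{ji} ≠ 1`. -/
theorem mem_of_rotates_of_adj {i j : Fin n} {v : List (Fin n)} (hij : q i j * q j i ≠ 1)
    (h₁ : Rotates q [i] (j :: v)) (h₂ : Rotates q [j] (v ++ [i])) (h₃ : Rotates q [i, j] v) :
    monomial q (i :: j :: v) ∈ nicholsBraidedLie q := by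
  refine h₃.mem_of_mem ?_
  unfold Rotates at h₁ h₂ h₃
  have h := sub_mem (add_mem h₁ (Submodule.smul_mem _
    (chi q (wordDeg [i]) (wordDeg (j :: v)) : F) h₂)) h₃
  have e1 : [i] ++ j :: v = [i, j] ++ v := rfl
  have e2 : j :: v ++ [i] = [j] ++ (v ++ [i]) := rfl
  have e3 : v ++ [i] ++ [j] = v ++ [i, j] := by simp
  rw [e1, e2, e3, smul_sub, sub_add_sub_cancel, sub_sub_sub_cancel_left, smul_smul] at h
  have hs : (chi q (wordDeg [i]) (wordDeg (j :: v)) : F) *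
      (chi q (wordDeg [j]) (wordDeg (v ++ [i])) : F) =
      (chi q (wordDeg [i, j]) (wordDeg v) : F) * ((q i j * q j i : Fˣ) : F) := by
    rw [← Units.val_mul, ← Units.val_mul, wordDeg_cons j v, wordDeg_append, wordDeg_cons i [j],
      chi_add_right, chi_add_right, chi_add_left, chi_singleton, chi_singleton]
    congr 1
    ac_rfl
  rw [hs] at h
  have h' : ((chi q (wordDeg [i, j]) (wordDeg v) : F) * (1 - ((q i j * q j i : Fˣ) : F))) •
      monomial q (v ++ [i, j]) ∈ nicholsBraidedLie q := by
    have h4 := sub_smul (chi q (wordDeg [i, j]) (wordDeg v) : F)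
      ((chi q (wordDeg [i, j]) (wordDeg v) : F) * ((q i j * q j i : Fˣ) : F))
      (monomial q (v ++ [i, j]))
    rw [mul_sub, mul_one]
    exact h4 ▸ h
  refine (Submodule.smul_mem_iff _ (mul_ne_zero (Units.ne_zero _) (sub_ne_zero.mpr ?_))).mp h'
  exact fun h1 => hij (Units.val_injective (by rw [← h1, Units.val_one]))

theorem monomial_pair_mem {i j : Fin n} (hij : q i j * q j i ≠ 1) :
    monomial q [i, j] ∈ nicholsBraidedLie q :=
  mem_of_rotates_of_adj hij
    (rotates_of_mem q (letter_mem_nicholsBraidedLie q i) (letter_mem_nicholsBraidedLie q j))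
    (rotates_of_mem q (letter_mem_nicholsBraidedLie q j) (letter_mem_nicholsBraidedLie q i))
    (rotates_nil q _)

theorem cutConnected_pair {i j : Fin n} (hij : q i j * q j i ≠ 1) :
    CutConnected q {k | k ∈ [i, j]} := by
  have := (cutConnected_singleton (q := q) i).union (cutConnected_singleton j) (i := i) (j := j)
    rfl rfl (.inr hij)
  convert this using 1
  ext
  simp [or_comm]

/-- The connected words of length `N` with at least two different letters lie in `𝔏(V)` if the
shorter ones do. -/
theorem ConnectedWordsMem.succ {N : ℕ} (hN : ConnectedWordsMem q N) :
    ConnectedWordsMem q (N + 1) := by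
  intro w hw hc h2
  have letter : ∀ {i : Fin n} {v : List (Fin n)}, w.Perm ([i] ++ v) → Rotates q [i] v := by
    intro i v hp
    refine rotates_of_connected hN (by rw [← hp.length_eq]; omega) ?_ ?_ ?_
      (letter_mem_nicholsBraidedLie q i)
    · simpa using cutConnected_singleton (q := q) i
    · simpa only [← hp.mem_iff] using hc
    · simpa only [← hp.mem_iff] using h2
  have block : ∀ {i j : Fin n} {v : List (Fin n)}, q i j * q j i ≠ 1 → w.Perm ([i, j] ++ v) →
      monomial q (i :: j :: v) ∈ nicholsBraidedLie q := by
    intro i j v hij hp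
    refine mem_of_rotates_of_adj hij (letter hp) (letter (hp.trans ?_)) ?_
    · have : ([i] ++ ([j] ++ v)).Perm (([j] ++ v) ++ [i]) := List.perm_append_comm
      simpa using this
    · refine rotates_of_connected hN (by rw [← hp.length_eq]; omega) (cutConnected_pair hij) ?_ ?_
        (monomial_pair_mem hij)
      · simpa only [← hp.mem_iff] using hc
      · simpa only [← hp.mem_iff] using h2
  have rotate : ∀ s t : List (Fin n), w.Perm (s ++ t) →
      monomial q (t ++ s) ∈ nicholsBraidedLie q → monomial q (s ++ t) ∈ nicholsBraidedLie q := by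
    intro s
    induction s with
    | nil => intro t _ h; simpa using h
    | cons a s ih =>
      intro t hp h
      refine (letter hp).mem_of_mem (v := s ++ t) ?_
      have e : s ++ t ++ [a] = s ++ (t ++ [a]) := List.append_assoc ..
      rw [e]
      refine ih _ (hp.trans ?_) (by simpa using h)
      rw [← e]
      exact List.perm_append_comm (l₁ := [a])
  -- Move the first letter `i` up to the first letter `k` with `q i k * q k i ≠ 1`.
  obtain ⟨x, hx, y, hy, hxy⟩ := h2
  obtain ⟨i, r, rfl⟩ := List.exists_cons_of_ne_nil (List.ne_nil_of_mem hx)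
  obtain ⟨j, hj, hne, hij⟩ : ∃ j ∈ {k | k ∈ i :: r}, i ≠ j ∧ q i j * q j i ≠ 1 := by
    by_cases hix : i = x
    · exact hc.exists_adj (by simp) hy (hix ▸ hxy)
    · exact hc.exists_adj (by simp) hx hix
  have hjr : j ∈ r := (List.mem_cons.mp hj).resolve_left hne.symm
  have first : ∀ r : List (Fin n), j ∈ r → ∃ s k t, r = s ++ k :: t ∧ q i k * q k i ≠ 1 ∧
      ∀ l ∈ s, q i l * q l i = 1 := by
    intro r
    induction r with
    | nil => intro h; simp at h
    | cons a r ih =>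
      intro hr
      by_cases ha : q i a * q a i = 1
      · have haj : j ≠ a := by rintro rfl; exact hij ha
        obtain ⟨s, k, t, rfl, hk, hs⟩ := ih ((List.mem_cons.mp hr).resolve_left haj)
        exact ⟨a :: s, k, t, rfl, hk, by simpa using ⟨ha, hs⟩⟩
      · exact ⟨[], a, r, rfl, ha, by simp⟩
  obtain ⟨s, k, t, rfl, hik, hs⟩ := first r hjr
  obtain ⟨c, hc'⟩ := exists_monomial_cons_eq_smul q (i := i) (v := s)
    fun l hl _ => hs l hl
  have e : monomial q (i :: (s ++ k :: t)) = (c : F) • monomial q (s ++ ([i, k] ++ t)) := by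
    have e1 : i :: (s ++ k :: t) = (i :: s) ++ k :: t := rfl
    have e2 : s ++ ([i, k] ++ t) = (s ++ [i]) ++ k :: t := by simp
    rw [e1, e2, monomial_append, hc', smul_mul_assoc, ← monomial_append]
  have p : (i :: (s ++ k :: t)).Perm (s ++ ([i, k] ++ t)) := List.perm_middle.symm
  rw [e]
  refine Submodule.smul_mem _ _ (rotate _ _ p ?_)
  rw [List.append_assoc]
  refine block hik (p.trans ?_)
  have : (s ++ ([i, k] ++ t)).Perm (([i, k] ++ t) ++ s) := List.perm_append_comm
  rwa [List.append_assoc] at this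

theorem monomial_mem_of_connected {w : List (Fin n)} (hc : CutConnected q {i | i ∈ w})
    (h2 : ∃ i ∈ w, ∃ j ∈ w, i ≠ j) : monomial q w ∈ nicholsBraidedLie q := by
  have : ∀ N, ConnectedWordsMem q N := fun N => by
    induction N with
    | zero => intro w hw; exact absurd hw (Nat.not_lt_zero _)
    | succ N ih => exact ih.succ
  exact this (w.length + 1) w (Nat.lt_succ_self _) hc h2

end NicholsDiag

/-! ### Homogeneous elements and their monomials -/

namespace NicholsDiag

variable {F : Type*} [Field F] {n : ℕ} {q : Fin n → Fin n → Fˣ}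

/-- All monomials of a nonzero homogeneous element have its multidegree. -/
theorem IsMonomialOf.wordDeg_eq {d : Fin n → ℕ} {u : NicholsAlgebra q} (hu0 : u ≠ 0)
    (hu : u ∈ homogeneousPart q d) {w : List (Fin n)} (hw : IsMonomialOf q u w) :
    wordDeg w = d := by
  obtain ⟨e, f, hf, rfl, hfw⟩ := hw
  rw [(hf w (Finsupp.mem_support_iff.mpr hfw)).1]
  refine homogeneousPart_degree_unique q hu0 (Submodule.sum_mem _ fun v hv => ?_) hu
  exact Submodule.smul_mem _ _ ((hf v hv).1 ▸ monomial_mem_homogeneousPart q v)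

theorem exists_isMonomialOf {d : Fin n → ℕ} {u : NicholsAlgebra q} (hu0 : u ≠ 0)
    (hu : u ∈ homogeneousPart q d) : ∃ w, IsMonomialOf q u w := by
  classical
  have hspan : u ∈ Submodule.span F (monomial q '' {w | wordDeg w = d ∧ monomial q w ≠ 0}) := by
    refine Submodule.span_le.mpr ?_ hu
    rintro _ ⟨w, hw, rfl⟩
    by_cases h : monomial q w = 0
    · rw [h]; exact zero_mem _
    · exact Submodule.subset_span ⟨w, ⟨hw, h⟩, rfl⟩
  obtain ⟨f, hf, rfl⟩ := (Finsupp.mem_span_image_iff_linearCombination F).mp hspan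
  have hf0 : f ≠ 0 := by rintro rfl; simp at hu0
  obtain ⟨w, hw⟩ := Finsupp.ne_iff.mp hf0
  exact ⟨w, d, f, fun v hv => hf hv, rfl, hw⟩

theorem mu_eq_degSupport {d : Fin n → ℕ} {u : NicholsAlgebra q} (hu0 : u ≠ 0)
    (hu : u ∈ homogeneousPart q d) : mu q u = degSupport d := by
  ext i
  constructor
  · rintro ⟨w, hw, hi⟩
    rw [← hw.wordDeg_eq hu0 hu, degSupport_wordDeg]
    exact hi
  · intro hi
    obtain ⟨w, hw⟩ := exists_isMonomialOf hu0 hu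
    rw [← hw.wordDeg_eq hu0 hu, degSupport_wordDeg] at hi
    exact ⟨w, hw, hi⟩

/-- A component whose multidegree has connected support lies in `𝔏(V)`, except possibly in the
degrees `k e_i` with `q i i = 1`. -/
theorem homogeneousPart_le_nicholsBraidedLie {d : Fin n → ℕ} (hc : CutConnected q (degSupport d))
    (hq : ∀ i, degSupport d = {i} → q i i ≠ 1) : homogeneousPart q d ≤ nicholsBraidedLie q := by
  refine Submodule.span_le.mpr ?_
  rintro _ ⟨w, rfl, rfl⟩
  rw [degSupport_wordDeg] at hc hq
  by_cases h2 : ∃ i ∈ w, ∃ j ∈ w, i ≠ j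
  · exact monomial_mem_of_connected hc h2
  · push Not at h2
    obtain ⟨i, hi⟩ := hc.1
    have hw := List.eq_replicate_of_mem fun j hj => h2 j hj i hi
    have hqi : q i i ≠ 1 := hq i (Set.ext fun j => ⟨fun hj => h2 j hj i hi, fun hj => hj ▸ hi⟩)
    obtain ⟨k, hk⟩ := Nat.exists_eq_succ_of_ne_zero
      (List.length_pos_iff.mpr (List.ne_nil_of_mem hi)).ne'
    rw [hw, hk]
    exact monomial_replicate_mem q hqi k

end NicholsDiag

theorem lemma3p1 {F : Type*} [Field F] [IsAlgClosed F] [CharZero F] {n : ℕ}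
    (q : Fin n → Fin n → Fˣ) (u : NicholsDiag.NicholsAlgebra q) (hu0 : u ≠ 0)
    (hu : ∃ d : Fin n → ℕ, u ∈ NicholsDiag.homogeneousPart q d)
    (hq : ∀ i : Fin n, NicholsDiag.mu q u = {i} → q i i ≠ 1) :
    (u ∈ NicholsDiag.nicholsBraidedLie q ↔
      NicholsDiag.ConnectedLetters q (NicholsDiag.mu q u)) ∧
    (NicholsDiag.ConnectedLetters q (NicholsDiag.mu q u) ↔
      ∀ w : List (Fin n), NicholsDiag.IsMonomialOf q u w →
        NicholsDiag.ConnectedLetters q {i | i ∈ w}) := by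
  obtain ⟨d, hd⟩ := hu
  have hletters : ∀ w, NicholsDiag.IsMonomialOf q u w →
      {i | i ∈ w} = NicholsDiag.degSupport d := fun w hw => by
    rw [← NicholsDiag.degSupport_wordDeg, hw.wordDeg_eq hu0 hd]
  rw [NicholsDiag.mu_eq_degSupport hu0 hd] at hq ⊢
  refine ⟨?_, fun h w hw => (hletters w hw).symm ▸ h, fun h => ?_⟩
  · rw [NicholsDiag.connectedLetters_iff_cutConnected]
    exact ⟨NicholsDiag.cutConnected_of_mem_nicholsBraidedLie q hu0 hd,
      fun h => NicholsDiag.homogeneousPart_le_nicholsBraidedLie h hq hd⟩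
  · obtain ⟨w, hw⟩ := NicholsDiag.exists_isMonomialOf hu0 hd
    exact hletters w hw ▸ h w hw
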